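/- **Theorem 1.1.** For a topological space $X$ let $PX$ be the space of continuous paths $\sigma:[0,1]\to X$ with the compact-open topology. Call a set $V\subset X\times X$ symmetric if $(x,y)\in V$ if and only if $(y,x)\in V$. A symmetric motion planning rule on a symmetric set $V$ is a continuous map $s:V\to PX$ such that, for all $(x,y)\in V$, the path $s(x,y)$ starts at $x$ and ends at $y$, and $s(y,x)(t)=s(x,y)(1-t)$ for all $t\in[0,1]$. For nonempty $X$, the reduced symmetrized topological complexity $\operatorname{TC}^{\Sigma}(X)$ is one less than the minimal number of symmetric open sets that cover $X\times X$ and each admit a symmetric motion planning rule (and $\infty$ if there is no finite such cover). Then $$\operatorname{TC}^{\Sigma}(S^1)=2.$$ -/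

import Mathlib

open scoped unitInterval

/-- A set `V ⊆ X × X` is symmetric if `(x, y) ∈ V` iff `(y, x) ∈ V`. -/
def IsSymmetricSet {X : Type*} (V : Set (X × X)) : Prop :=
  ∀ x y : X, (x, y) ∈ V ↔ (y, x) ∈ V

/-- `s : V → PX` is a motion planning rule on `V`: a continuous section over `V` of the endpoint
map `PX → X × X`, `σ ↦ (σ 0, σ 1)`. The path space `PX` is `C(I, X)` with its compact-open
topology. -/
structure IsMotionPlanningRule {X : Type*} [TopologicalSpace X] (V : Set (X × X))
    (s : V → C(I, X)) : Prop where
  continuous : Continuous s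
  source : ∀ p : V, s p 0 = p.1.1
  target : ∀ p : V, s p 1 = p.1.2

/-- A motion planning rule is symmetric if `s (y, x)` is the reverse `t ↦ s (x, y) (1 - t)` of
`s (x, y)`. -/
structure IsSymmetricMotionPlanningRule {X : Type*} [TopologicalSpace X] (V : Set (X × X))
    (s : V → C(I, X)) : Prop extends IsMotionPlanningRule V s where
  symm : ∀ (x y : X) (hxy : (x, y) ∈ V) (hyx : (y, x) ∈ V) (t : I),
    s ⟨(y, x), hyx⟩ t = s ⟨(x, y), hxy⟩ (unitInterval.symm t)

/-- `X × X` is covered by `k` symmetric open sets, each of which admits a symmetric motion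
planning rule. -/
def HasSymmetricMotionPlanningCover (X : Type*) [TopologicalSpace X] (k : ℕ) : Prop :=
  ∃ V : Fin k → Set (X × X),
    (∀ i, IsOpen (V i) ∧ IsSymmetricSet (V i) ∧
      ∃ s : V i → C(I, X), IsSymmetricMotionPlanningRule (V i) s) ∧
    ⋃ i, V i = Set.univ

/-- The reduced symmetrized topological complexity of a (nonempty) space: the least `n` such that
`X × X` is covered by `n + 1` symmetric open sets admitting symmetric motion planning rules; it is
`⊤` if there is no such `n`. -/
noncomputable def symmetrizedTC (X : Type*) [TopologicalSpace X] : ℕ∞ :=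
  ⨅ (n : ℕ) (_ : HasSymmetricMotionPlanningCover X (n + 1)), (n : ℕ∞)

/-! Lower bound: lifting a symmetric rule to `ℝ` gives an antisymmetric angle from `x` to `y`. In
coordinates (midpoint `m`, difference `d`) it differs from `d` by a multiple of `2π`, which yields a
sign: `1` on the diagonal `d = 0`, and odd under `m ↦ m + π` on the antipodal circle `d = π`, where
that shift swaps the points. Two sets covering the square would combine, through a partition of
unity, into a nonvanishing planar map on the cylinder, null-homotopic at `d = 0` but odd at `d = π`.
An odd loop has odd degree: contradiction. Upper bound: three explicit sets with angles built from
`Complex.arg`. -/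

/-! ### Degree obstruction on the cylinder -/

/-- A continuous complex function with constant exponential on a preconnected space is constant. -/
theorem Complex.eq_of_exp_comp_const {A : Type*} [TopologicalSpace A] [PreconnectedSpace A]
    {g : A → ℂ} (hg : Continuous g) (h : ∀ a b, Complex.exp (g a) = Complex.exp (g b)) (a b : A) :
    g a = g b :=
  Complex.isCoveringMap_exp.const_of_comp hg (fun a b ↦ Subtype.ext (h a b)) a b

/-- There is no continuous nonvanishing function on a cylinder that is null-homotopic on one
boundary circle and antipode-preserving on the other. -/
theorem not_exists_antipodal_nullhomotopy {G : ℝ × ℝ → ℂ} (hG : Continuous G)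
    (hG0 : ∀ p, G p ≠ 0) (hper : ∀ m d, G (m + 2 * Real.pi, d) = G (m, d))
    (hslit : ∀ m, G (m, 0) ∈ Complex.slitPlane)
    (hanti : ∀ m, G (m + Real.pi, Real.pi) = -G (m, Real.pi)) : False := by
  obtain ⟨L, ⟨-, hL⟩, -⟩ := Complex.isCoveringMapOn_exp.existsUnique_continuousMap_lifts
    (⟨G, hG⟩ : C(ℝ × ℝ, ℂ)) (a₀ := (0, 0)) (Complex.exp_log (hG0 (0, 0))) (fun p ↦ hG0 p)
  replace hL (p : ℝ × ℝ) : Complex.exp (L p) = G p := congr_fun hL p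
  have hbot (m : ℝ) : L (m + 2 * Real.pi, 0) = L (m, 0) := by
    -- On the slit plane the principal logarithm is a periodic branch, so `L` differs from it by a
    -- constant.
    have hc : Continuous fun m : ℝ ↦ L (m, 0) - Complex.log (G (m, 0)) := by
      refine (by fun_prop : Continuous fun m : ℝ ↦ L (m, 0)).sub ?_
      exact Continuous.clog (by fun_prop) hslit
    have := Complex.eq_of_exp_comp_const hc
      (fun a b ↦ by simp [Complex.exp_sub, Complex.exp_log, hL, hG0]) (m + 2 * Real.pi) m
    simpa [hper] using this
  have hperL (m d : ℝ) : L (m + 2 * Real.pi, d) = L (m, d) := by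
    have hc : Continuous fun p : ℝ × ℝ ↦ L (p.1 + 2 * Real.pi, p.2) - L p := by fun_prop
    have := Complex.eq_of_exp_comp_const hc
      (fun a b ↦ by simp [Complex.exp_sub, hL, hG0, hper]) (m, d) (m, 0)
    simpa [hbot, sub_eq_zero] using this
  -- The half-period increment is a constant `c`. Periodicity gives `2c = 0`, while oddness needs
  -- `exp c = -1`.
  have hc : Continuous fun m : ℝ ↦ L (m + Real.pi, Real.pi) - L (m, Real.pi) := by fun_prop
  have h := Complex.eq_of_exp_comp_const hc
    (fun a b ↦ by simp [Complex.exp_sub, hL, hG0, hanti]) Real.pi 0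
  have h1 := hperL 0 Real.pi
  rw [zero_add, two_mul] at h1
  simp only [h1, zero_add] at h
  have h2 : L (Real.pi, Real.pi) = L (0, Real.pi) := by linear_combination -h / 2
  have h3 := hanti 0
  rw [zero_add, ← hL, ← hL, h2] at h3
  exact Complex.exp_ne_zero _ (self_eq_neg.mp h3)

/-! ### From rules to angles and signs -/

/-- A symmetric motion planning rule on the circle determines a continuous, antisymmetric choice
of angle between the two points. -/
theorem IsSymmetricMotionPlanningRule.exists_angle {V : Set (Circle × Circle)}
    (hV : IsSymmetricSet V) {s : V → C(I, Circle)} (hs : IsSymmetricMotionPlanningRule V s) :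
    ∃ θ : Circle × Circle → ℝ, ContinuousOn θ V ∧
      (∀ x y, (x, y) ∈ V → Circle.exp (θ (x, y)) * x = y) ∧
      ∀ x y, (x, y) ∈ V → θ (y, x) = -θ (x, y) := by
  classical
  have hsc : Continuous fun q : I × V ↦ s q.2 q.1 := by
    have := hs.continuous
    fun_prop
  let H : C(I × V, Circle) := ⟨fun q ↦ s q.2 q.1 / q.2.1.1, hsc.div' (by fun_prop)⟩
  have H_0 (p : V) : H (0, p) = Circle.exp ((0 : C(V, ℝ)) p) := by
    simp [H, hs.source]
  let L := Circle.isCoveringMap_exp.liftHomotopy H 0 H_0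
  have hL0 (p : V) : L (0, p) = 0 := Circle.isCoveringMap_exp.liftHomotopy_zero H 0 H_0 p
  have hL (q : I × V) : Circle.exp (L q) = s q.2 q.1 / q.2.1.1 :=
    congr_fun (Circle.isCoveringMap_exp.liftHomotopy_lifts H 0 H_0) q
  refine ⟨fun p ↦ if hp : p ∈ V then L (1, ⟨p, hp⟩) else 0, ?_, fun x y h ↦ ?_, fun x y h ↦ ?_⟩
  · rw [continuousOn_iff_continuous_domRestrict]
    convert (by fun_prop : Continuous fun p : V ↦ L (1, p)) with p
    simp
  · simp [h, hL, hs.target]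
  · have h' := (hV x y).1 h
    simp only [h, h', dif_pos]
    -- Both functions lift `t ↦ s (y, x) t / y` and vanish at `0`; compare them at `1`.
    have := Circle.isCoveringMap_exp.eq_of_comp_eq (A := I)
      (g₁ := fun t ↦ L (t, ⟨(y, x), h'⟩))
      (g₂ := fun t ↦ L (unitInterval.symm t, ⟨(x, y), h⟩) - L (1, ⟨(x, y), h⟩))
      (by fun_prop) (by fun_prop)
      (by ext1 t; simp [hL, hs.target, hs.symm x y h h']) 0 (by simp [hL0])
    simpa [hL0] using congr_fun this 1

/-- Where `ε` may be discontinuous, `u` vanishes and the bound on `ε` squeezes the product to `0`.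
-/
theorem Continuous.mul_of_continuousOn {X : Type*} [TopologicalSpace X] {U : Set X}
    (hU : IsOpen U) {u ε : X → ℝ} (hu : Continuous u) (hu0 : ∀ p ∉ U, u p = 0)
    (hε : ContinuousOn ε U) (hε1 : ∀ p, |ε p| ≤ 1) : Continuous fun p ↦ u p * ε p := by
  refine continuous_iff_continuousAt.2 fun p ↦ ?_
  by_cases hp : p ∈ U
  · exact hu.continuousAt.mul (hε.continuousAt (hU.mem_nhds hp))
  · rw [ContinuousAt, hu0 p hp, zero_mul]
    refine squeeze_zero_norm (a := fun q ↦ |u q|) (fun q ↦ ?_) ?_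
    · rw [norm_mul]
      exact mul_le_of_le_one_right (norm_nonneg _) (hε1 q)
    · simpa [hu0 p hp] using hu.abs.tendsto p

/-- Two symmetric open sets covering the square of a normal space have a symmetric subordinate
partition of unity. -/
theorem exists_symmetric_partition {X : Type*} [TopologicalSpace X] [NormalSpace (X × X)]
    {U V : Set (X × X)} (hU : IsOpen U) (hV : IsOpen V) (hUs : IsSymmetricSet U)
    (hVs : IsSymmetricSet V) (hUV : U ∪ V = Set.univ) :
    ∃ u : X × X → ℝ, Continuous u ∧ (∀ p, 0 ≤ u p) ∧ (∀ p, u p ≤ 1) ∧ (∀ p ∉ U, u p = 0) ∧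
      (∀ p ∉ V, u p = 1) ∧ ∀ x y, u (y, x) = u (x, y) := by
  obtain ⟨f, hf0, hf1, hf⟩ := exists_continuous_zero_one_of_isClosed hU.isClosed_compl
    hV.isClosed_compl (Set.disjoint_left.2 fun p h1 h2 ↦
      (hUV ▸ Set.mem_univ p : p ∈ U ∪ V).elim h1 h2)
  refine ⟨fun p ↦ (f p + f p.swap) / 2, by fun_prop, fun p ↦ ?_, fun p ↦ ?_, fun p hp ↦ ?_,
    fun p hp ↦ ?_, fun x y ↦ by simp [add_comm]⟩
  · linarith [(hf p).1, (hf p.swap).1]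
  · linarith [(hf p).2, (hf p.swap).2]
  · have h1 : f p = 0 := hf0 hp
    have h2 : f p.swap = 0 := hf0 fun h ↦ hp ((hUs _ _).1 h)
    simp [h1, h2]
  · have h1 : f p = 1 := hf1 hp
    have h2 : f p.swap = 1 := hf1 fun h ↦ hp ((hVs _ _).1 h)
    simp only [h1, h2]
    norm_num

/-- The pair of points on the circle with midpoint angle `m` and angular difference `d`. -/
noncomputable def circlePair (p : ℝ × ℝ) : Circle × Circle :=
  (Circle.exp (p.1 - p.2 / 2), Circle.exp (p.1 + p.2 / 2))

theorem continuous_circlePair : Continuous circlePair := by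
  unfold circlePair
  fun_prop

theorem circlePair_add_two_pi (m d : ℝ) : circlePair (m + 2 * Real.pi, d) = circlePair (m, d) := by
  simp [circlePair, Circle.exp_add, Circle.exp_sub]

theorem circlePair_add_pi (m : ℝ) :
    circlePair (m + Real.pi, Real.pi) = (circlePair (m, Real.pi)).swap := by
  have h1 : m + Real.pi - Real.pi / 2 = m + Real.pi / 2 := by ring
  have h2 : m + Real.pi + Real.pi / 2 = m - Real.pi / 2 + 2 * Real.pi := by ring
  simp only [circlePair, Prod.swap_prod_mk, h1, h2, Circle.exp_add_two_pi]

theorem circlePair_zero (m : ℝ) : circlePair (m, 0) = (Circle.exp m, Circle.exp m) := by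
  simp [circlePair]

theorem max_neg_one_min_one_neg (r : ℝ) : max (-1) (min 1 (-r)) = -max (-1) (min 1 r) := by
  rw [← min_neg_neg, ← max_neg_neg, neg_neg, max_min_distrib_left, max_eq_right (by norm_num)]

/-- A continuous antisymmetric choice of angle on `V` determines a continuous sign function on the
preimage of `V` under `circlePair`. -/
theorem exists_sign_of_angle {V : Set (Circle × Circle)} {θ : Circle × Circle → ℝ}
    (hθ : ContinuousOn θ V) (hexp : ∀ x y, (x, y) ∈ V → Circle.exp (θ (x, y)) * x = y)
    (hanti : ∀ x y, (x, y) ∈ V → θ (y, x) = -θ (x, y)) :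
    ∃ ε : ℝ × ℝ → ℝ, ContinuousOn ε (circlePair ⁻¹' V) ∧ (∀ p, |ε p| ≤ 1) ∧
      (∀ p, circlePair p ∈ V → ε p ≠ 0) ∧ (∀ m d, ε (m + 2 * Real.pi, d) = ε (m, d)) ∧
      (∀ m, circlePair (m, 0) ∈ V → ε (m, 0) = 1) ∧
      ∀ m, circlePair (m, Real.pi) ∈ V → ε (m + Real.pi, Real.pi) = -ε (m, Real.pi) := by
  have hpi := Real.pi_ne_zero
  -- Over `V` the quotient is an odd integer, so clamping returns its sign. The shift by `π` makes
  -- it `1` at `d = 0` and `θ / π` at `d = π`.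
  refine ⟨fun p ↦ max (-1) (min 1 ((θ (circlePair p) - p.2 + Real.pi) / Real.pi)), ?_, fun p ↦ ?_,
    fun p hp ↦ ?_, fun m d ↦ ?_, fun m hm ↦ ?_, fun m hm ↦ ?_⟩
  · have := hθ.comp continuous_circlePair.continuousOn (Set.mapsTo_preimage _ _)
    simp only [Function.comp_def] at this
    exact (continuous_const.max (continuous_const.min continuous_id)).comp_continuousOn
      (((this.sub continuousOn_snd).add continuousOn_const).div_const _)
  · exact abs_le.2 ⟨le_max_left _ _, max_le (by norm_num) (min_le_left _ _)⟩
  · have h1 : Circle.exp (θ (circlePair p)) = Circle.exp p.2 := by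
      have h := hexp _ _ hp
      rw [← eq_div_iff_mul_eq', ← Circle.exp_sub] at h
      exact h.trans (by ring_nf)
    obtain ⟨n, hn⟩ := Circle.exp_eq_exp.1 h1
    have h2 : (θ (circlePair p) - p.2 + Real.pi) / Real.pi = ((2 * n + 1 : ℤ) : ℝ) := by
      rw [hn]
      push_cast
      field_simp
      ring
    simp only [h2]
    rcases le_or_gt 0 n with h0 | h0
    · have : (1 : ℝ) ≤ ((2 * n + 1 : ℤ) : ℝ) := by exact_mod_cast (by lia)
      rw [min_eq_left this]
      norm_num
    · have : ((2 * n + 1 : ℤ) : ℝ) ≤ -1 := by exact_mod_cast (by lia)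
      rw [max_eq_left ((min_le_right _ _).trans this)]
      norm_num
  · simp only [circlePair_add_two_pi]
  · rw [circlePair_zero] at hm
    have h0 : θ (Circle.exp m, Circle.exp m) = 0 := by linarith [hanti _ _ hm]
    simp [circlePair_zero, h0, hpi]
  · have h : θ (circlePair (m, Real.pi)).swap = -θ (circlePair (m, Real.pi)) := hanti _ _ hm
    simp only [circlePair_add_pi, h, sub_add_cancel, neg_div]
    exact max_neg_one_min_one_neg _

/-- The square of the circle is not the union of two symmetric open sets that admit symmetric
motion planning rules. -/
theorem circle_not_covered_by_two {U V : Set (Circle × Circle)} (hU : IsOpen U) (hV : IsOpen V)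
    (hUs : IsSymmetricSet U) (hVs : IsSymmetricSet V) {s : U → C(I, Circle)} {t : V → C(I, Circle)}
    (hs : IsSymmetricMotionPlanningRule U s) (ht : IsSymmetricMotionPlanningRule V t) :
    U ∪ V ≠ Set.univ := by
  intro hUV
  obtain ⟨u, hu, hu0, hu1, huU, huV, husymm⟩ := exists_symmetric_partition hU hV hUs hVs hUV
  obtain ⟨θ, h1, h2, h3⟩ := hs.exists_angle hUs
  obtain ⟨a, ha, ha1, ha0, haper, habot, hatop⟩ := exists_sign_of_angle h1 h2 h3
  obtain ⟨θ', h1', h2', h3'⟩ := ht.exists_angle hVs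
  obtain ⟨b, hb, hb1, hb0, hbper, hbbot, hbtop⟩ := exists_sign_of_angle h1' h2' h3'
  have hA : Continuous fun p ↦ u (circlePair p) * a p :=
    (hu.comp continuous_circlePair).mul_of_continuousOn
      (hU.preimage continuous_circlePair) (fun p hp ↦ huU _ hp) ha ha1
  have hB : Continuous fun p ↦ (1 - u (circlePair p)) * b p :=
    (continuous_const.sub (hu.comp continuous_circlePair)).mul_of_continuousOn
      (hV.preimage continuous_circlePair) (fun p hp ↦ sub_eq_zero.2 (huV _ hp).symm) hb hb1
  refine not_exists_antipodal_nullhomotopy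
    (G := fun p ↦ ⟨u (circlePair p) * a p, (1 - u (circlePair p)) * b p⟩) ?_ (fun p h ↦ ?_)
    (fun m d ↦ ?_) (fun m ↦ ?_) fun m ↦ ?_
  · exact Complex.equivRealProdCLM.symm.continuous.comp (hA.prodMk hB)
  · obtain ⟨hre, him⟩ := Complex.ext_iff.1 h
    simp only [Complex.zero_re, Complex.zero_im, mul_eq_zero] at hre him
    by_cases hpV : circlePair p ∈ V
    · have h1 : 1 - u (circlePair p) = 0 := him.resolve_right (hb0 p hpV)
      have h2 : u (circlePair p) ≠ 0 := by linarith
      exact ha0 p (by_contra fun hpU ↦ h2 (huU _ hpU)) (hre.resolve_left h2)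
    · have h1 := huV _ hpV
      have h2 : u (circlePair p) ≠ 0 := by simp [h1]
      exact ha0 p (by_contra fun hpU ↦ h2 (huU _ hpU)) (hre.resolve_left h2)
  · simp only [circlePair_add_two_pi, haper, hbper]
  -- At `d = 0` the map takes values `(u, 1 - u)`, on the segment from `1` to `I`.
  · have hre : u (circlePair (m, 0)) * a (m, 0) = u (circlePair (m, 0)) := by
      by_cases h : circlePair (m, 0) ∈ U
      · rw [habot m h, mul_one]
      · simp [huU _ h]
    have him : (1 - u (circlePair (m, 0))) * b (m, 0) = 1 - u (circlePair (m, 0)) := by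
      by_cases h : circlePair (m, 0) ∈ V
      · rw [hbbot m h, mul_one]
      · simp [huV _ h]
    simp only [hre, him, Complex.mem_slitPlane_iff]
    rcases (hu0 (circlePair (m, 0))).lt_or_eq with h | h
    · exact Or.inl h
    · exact Or.inr (by simp [← h])
  · have hsw : u (circlePair (m, Real.pi)).swap = u (circlePair (m, Real.pi)) := husymm _ _
    simp only [circlePair_add_pi, hsw]
    apply Complex.ext
    · by_cases h : circlePair (m, Real.pi) ∈ U
      · simp [hatop m h]
      · simp [huU _ h]
    · by_cases h : circlePair (m, Real.pi) ∈ V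
      · simp [hbtop m h]
      · simp [huV _ h]

/-! ### Upper bound: three explicit sets -/

/-- A continuous antisymmetric choice of angle determines a symmetric motion planning rule. -/
theorem exists_symmetricRule_of_angle {V : Set (Circle × Circle)} {θ : Circle × Circle → ℝ}
    (hθ : ContinuousOn θ V) (hexp : ∀ x y, (x, y) ∈ V → Circle.exp (θ (x, y)) * x = y)
    (hanti : ∀ x y, (x, y) ∈ V → θ (y, x) = -θ (x, y)) :
    ∃ s : V → C(I, Circle), IsSymmetricMotionPlanningRule V s := by
  have hc : Continuous fun q : V × I ↦ Circle.exp (q.2 * θ q.1) * q.1.1.1 := by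
    have := continuousOn_iff_continuous_domRestrict.1 hθ
    have : Continuous fun q : V ↦ θ q := this
    exact (Circle.exp.continuous.comp ((continuous_subtype_val.comp continuous_snd).mul
      (this.comp continuous_fst))).mul (by fun_prop)
  refine ⟨ContinuousMap.curry ⟨_, hc⟩, ⟨ContinuousMap.continuous _, fun p ↦ ?_, fun p ↦ ?_⟩,
    fun x y hxy hyx t ↦ ?_⟩
  · simp
  · simpa using hexp _ _ p.2
  · simp only [ContinuousMap.curry_apply, ContinuousMap.coe_mk, unitInterval.coe_symm_eq,
      hanti x y hxy]
    nth_rw 2 [← hexp x y hxy]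
    rw [← mul_assoc, ← Circle.exp_add]
    ring_nf

theorem Circle.coe_eq_neg_one_of_notMem_slitPlane {z : Circle} (h : (z : ℂ) ∉ Complex.slitPlane) :
    (z : ℂ) = -1 := by
  simp only [Complex.mem_slitPlane_iff, not_or, not_lt, not_not] at h
  have h1 := Circle.normSq_coe z
  rw [Complex.normSq_apply, h.2] at h1
  apply Complex.ext
  · simp only [Complex.neg_re, Complex.one_re]
    nlinarith [h.1]
  · simp [h.2]

/-- The pairs of points of the circle that are not antipodal. -/
def nonAntipodal : Set (Circle × Circle) :=
  {p | ((p.2 / p.1 : Circle) : ℂ) ∈ Complex.slitPlane}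

/-- The pairs of points of the circle that both differ from `-b`. -/
def avoidingNeg (b : Circle) : Set (Circle × Circle) :=
  {p | ((p.1 / b : Circle) : ℂ) ∈ Complex.slitPlane ∧
    ((p.2 / b : Circle) : ℂ) ∈ Complex.slitPlane}

theorem isOpen_nonAntipodal : IsOpen nonAntipodal := by
  have h : Continuous fun p : Circle × Circle ↦ p.2 / p.1 := by fun_prop
  exact Complex.isOpen_slitPlane.preimage (continuous_subtype_val.comp h)

theorem isOpen_avoidingNeg (b : Circle) : IsOpen (avoidingNeg b) := by
  have h1 : Continuous fun p : Circle × Circle ↦ p.1 / b := by fun_prop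
  have h2 : Continuous fun p : Circle × Circle ↦ p.2 / b := by fun_prop
  exact (Complex.isOpen_slitPlane.preimage (continuous_subtype_val.comp h1)).inter
    (Complex.isOpen_slitPlane.preimage (continuous_subtype_val.comp h2))

theorem isSymmetricSet_nonAntipodal : IsSymmetricSet nonAntipodal := fun x y ↦ by
  change ((y / x : Circle) : ℂ) ∈ Complex.slitPlane ↔ ((x / y : Circle) : ℂ) ∈ Complex.slitPlane
  rw [← inv_div x y, Circle.coe_inv_eq_conj]
  rw [Complex.mem_slitPlane_iff, Complex.mem_slitPlane_iff, Complex.conj_re, Complex.conj_im,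
    neg_ne_zero]

theorem isSymmetricSet_avoidingNeg (b : Circle) : IsSymmetricSet (avoidingNeg b) :=
  fun _ _ ↦ and_comm

theorem exists_symmetricRule_nonAntipodal :
    ∃ s : nonAntipodal → C(I, Circle), IsSymmetricMotionPlanningRule nonAntipodal s := by
  refine exists_symmetricRule_of_angle (θ := fun p ↦ Complex.arg (p.2 / p.1 : Circle))
    (fun p hp ↦ ?_) (fun x y _ ↦ by rw [Circle.exp_arg, div_mul_cancel]) fun x y h ↦ ?_
  · refine ((Complex.continuousAt_arg hp).comp (f := fun p : Circle × Circle ↦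
      ((p.2 / p.1 : Circle) : ℂ)) ?_).continuousWithinAt
    exact (continuous_subtype_val.comp (continuous_snd.div' continuous_fst)).continuousAt
  · have h1 : Complex.arg (y / x : Circle) ≠ Real.pi := (Complex.mem_slitPlane_iff_arg.1 h).1
    simp only
    rw [← inv_div, Circle.coe_inv, Complex.arg_inv, if_neg h1]

theorem exists_symmetricRule_avoidingNeg (b : Circle) :
    ∃ s : avoidingNeg b → C(I, Circle), IsSymmetricMotionPlanningRule (avoidingNeg b) s := by
  refine exists_symmetricRule_of_angle
    (θ := fun p ↦ Complex.arg (p.2 / b : Circle) - Complex.arg (p.1 / b : Circle))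
    (fun p hp ↦ ContinuousAt.continuousWithinAt (ContinuousAt.sub ?_ ?_))
    (fun x y _ ↦ by rw [Circle.exp_sub, Circle.exp_arg, Circle.exp_arg]; simp)
    fun x y h ↦ (neg_sub _ _).symm
  · refine (Complex.continuousAt_arg hp.2).comp (f := fun p : Circle × Circle ↦
      ((p.2 / b : Circle) : ℂ)) ?_
    exact (continuous_subtype_val.comp (continuous_snd.div' continuous_const)).continuousAt
  · refine (Complex.continuousAt_arg hp.1).comp (f := fun p : Circle × Circle ↦
      ((p.1 / b : Circle) : ℂ)) ?_
    exact (continuous_subtype_val.comp (continuous_fst.div' continuous_const)).continuousAt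

/-- An antipodal pair containing `-1` consists of `1` and `-1`, so it avoids `-i`. -/
theorem mem_union_nonAntipodal_avoidingNeg {i : Circle} (hi : (i : ℂ) = Complex.I)
    (p : Circle × Circle) : p ∈ nonAntipodal ∨ p ∈ avoidingNeg 1 ∨ p ∈ avoidingNeg i := by
  obtain ⟨x, y⟩ := p
  by_contra! h
  obtain ⟨h0, h1, h2⟩ := h
  have h0' : (y : ℂ) = -1 * x := by
    rw [← div_eq_iff (Circle.coe_ne_zero x), ← Circle.coe_div]
    exact Circle.coe_eq_neg_one_of_notMem_slitPlane h0
  have hxy : (x : ℂ) = 1 ∧ (y : ℂ) = -1 ∨ (x : ℂ) = -1 ∧ (y : ℂ) = 1 := by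
    rcases not_and_or.1 h1 with h1 | h1
    · have h3 : (x : ℂ) = -1 := by simpa using Circle.coe_eq_neg_one_of_notMem_slitPlane h1
      exact Or.inr ⟨h3, by simp [h0', h3]⟩
    · have h3 : (y : ℂ) = -1 := by simpa using Circle.coe_eq_neg_one_of_notMem_slitPlane h1
      exact Or.inl ⟨by linear_combination h0' - h3, h3⟩
  apply h2
  simp only [avoidingNeg, Set.mem_ofPred_eq, Circle.coe_div, hi]
  rcases hxy with ⟨hx, hy⟩ | ⟨hx, hy⟩ <;>
    simp [hx, hy, Complex.mem_slitPlane_iff]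

theorem hasSymmetricMotionPlanningCover_circle : HasSymmetricMotionPlanningCover Circle 3 := by
  let i : Circle := ⟨Complex.I, mem_sphere_zero_iff_norm.2 Complex.norm_I⟩
  refine ⟨![nonAntipodal, avoidingNeg 1, avoidingNeg i], ?_, ?_⟩
  · simp only [Fin.forall_fin_succ, Matrix.cons_val_zero,
      Matrix.cons_val_succ, IsEmpty.forall_iff, and_true]
    exact ⟨⟨isOpen_nonAntipodal, isSymmetricSet_nonAntipodal, exists_symmetricRule_nonAntipodal⟩,
      ⟨isOpen_avoidingNeg 1, isSymmetricSet_avoidingNeg 1, exists_symmetricRule_avoidingNeg 1⟩,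
      ⟨isOpen_avoidingNeg i, isSymmetricSet_avoidingNeg i, exists_symmetricRule_avoidingNeg i⟩⟩
  · refine Set.eq_univ_of_forall fun p ↦ Set.mem_iUnion.2 ?_
    rcases mem_union_nonAntipodal_avoidingNeg (i := i) rfl p with h | h | h
    exacts [⟨0, h⟩, ⟨1, h⟩, ⟨2, h⟩]

theorem theorem1p1 : symmetrizedTC Circle = 2 := by
  refine le_antisymm (iInf₂_le 2 hasSymmetricMotionPlanningCover_circle) (le_iInf₂ fun n h ↦ ?_)
  obtain ⟨V, hV, hcover⟩ := h
  by_contra hn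
  have hn : n < 2 := by exact_mod_cast not_le.1 hn
  obtain ⟨hU, hUs, s, hs⟩ := hV 0
  -- For `n = 0` this is the same set again, so one-set covers need no separate case.
  obtain ⟨hW, hWs, t, ht⟩ := hV (Fin.last n)
  refine circle_not_covered_by_two hU hW hUs hWs hs ht (Set.eq_univ_of_forall fun p ↦ ?_)
  obtain ⟨j, hj⟩ := Set.mem_iUnion.1 (hcover ▸ Set.mem_univ p : p ∈ ⋃ j, V j)
  have : j = 0 ∨ j = Fin.last n := by
    rw [Fin.ext_iff, Fin.ext_iff, Fin.val_zero, Fin.val_last]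
    lia
  rcases this with rfl | rfl
  exacts [Or.inl hj, Or.inr hj]
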